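/- For $(x,t)\in\mathbb R\times(0,\infty)$ put $$\phi_0(x,t)=\sum_{k\in\mathbb Z}(x+2kt)\,e^{-2(kx+k^2t)},\qquad \phi_a(x,t)=\frac{\pi}{\sinh(a\pi)}\sum_{k\in\mathbb Z}\sin(ax+2kat)\,e^{-2(kx+k^2t)}\quad(a\in\mathbb R\setminus\{0\}).$$ Let $C(\mathbb R_+)$ be the space of continuous functions $[0,\infty)\to\mathbb R$, with coordinate process $(X_t)_{t\ge 0}$, its natural filtration $(\mathcal F_t)_{t\ge 0}$, and the $\sigma$-algebra generated by the coordinates. For $x\in\mathbb R$ let $\mathbb W_x$ be Wiener measure on $C(\mathbb R_+)$, under which $(X_t)_{t\ge0}$ is a Brownian motion started at $x$. For $u>0$ let $T_u=\inf\{t\ge 0: X_t=0\text{ or }X_t=t+u\}$ (with $\inf\emptyset=\infty$), and for $0<x<u$ let $\mathbb Q_{x,u}$ be the probability measure on $C(\mathbb R_+)$ determined by $$\mathbb Q_{x,u}(A)=\mathbb W_x\Big[\frac{\phi_0(X_t,t+u)}{\phi_0(x,u)}\,\mathbf 1_{\{T_u>t\}\cap A}\Big],\qquad t\ge 0,\ A\in\mathcal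 F_t .$$ Then for all $r,t,u>0$, $x\in(0,u)$ and $a\in\mathbb R$, the random variables $\frac{\phi_a(X_t,t+u)}{\phi_0(X_t,t+u)}$ and $\frac{\phi_a(X_{t+r},t+r+u)}{\phi_0(X_{t+r},t+r+u)}$ (defined $\mathbb Q_{x,u}$-almost surely) are $\mathbb Q_{x,u}$-integrable, $$\mathbb E_{\mathbb Q_{x,u}}\Big[\frac{\phi_a(X_t,t+u)}{\phi_0(X_t,t+u)}\Big]=\frac{\phi_a(x,u)}{\phi_0(x,u)}\,e^{-\frac{a^2}{2}t},$$ and, $\mathbb Q_{x,u}$-almost surely, $$\mathbb E_{\mathbb Q_{x,u}}\Big[\frac{\phi_a(X_{t+r},t+r+u)}{\phi_0(X_{t+r},t+r+u)}\,\Big|\,\mathcal F_r\Big]=\frac{\phi_a(X_r,r+u)}{\phi_0(X_r,r+u)}\,e^{-\frac{a^2}{2}t}.$$ -/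

import Mathlib

open MeasureTheory ProbabilityTheory
open scoped NNReal ENNReal

namespace SpaceTimeBM

noncomputable section

/-- The theta-type functions `φ_a(x, t)`, for `a ≠ 0` and for `a = 0`
(used for `t > 0`, where both series converge absolutely). -/
def phi (a x t : ℝ) : ℝ :=
  if a = 0 then
    ∑' k : ℤ, (x + 2 * k * t) * Real.exp (-2 * (k * x + (k : ℝ) ^ 2 * t))
  else
    Real.pi / Real.sinh (a * Real.pi) *
      ∑' k : ℤ, Real.sin (a * x + 2 * k * a * t) * Real.exp (-2 * (k * x + (k : ℝ) ^ 2 * t))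

/-- The set `C(ℝ₊)` of continuous real functions on `[0, ∞)`. As a subtype of `ℝ≥0 → ℝ` it
carries the σ-algebra generated by the coordinate maps. -/
abbrev PathSpace : Type := {ω : ℝ≥0 → ℝ // Continuous ω}

/-- The coordinate process `X_t(ω) = ω(t)`. -/
def X (t : ℝ≥0) (ω : PathSpace) : ℝ := ω.1 t

theorem measurable_X (t : ℝ≥0) : Measurable (X t) :=
  (measurable_pi_apply t).comp measurable_subtype_coe

/-- The natural filtration `(𝓕_t)` of the coordinate process. -/
def naturalFiltration : Filtration ℝ≥0 (inferInstance : MeasurableSpace PathSpace) :=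
  Filtration.natural X fun t => (measurable_X t).stronglyMeasurable

/-- `W` is the Wiener measure `𝕎_x` on `C(ℝ₊)`: under `W` the coordinate process is a
Brownian motion started at `x`. -/
def IsWienerMeasure (x : ℝ) (W : Measure PathSpace) : Prop :=
  IsBrownianReal (fun t ω => X t ω - x) W

/-- The stopping time `T_u = inf {t ≥ 0 : X_t = 0 or X_t = t + u}`, with `inf ∅ = ∞`. -/
def exitTime (u : ℝ) (ω : PathSpace) : ℝ≥0∞ :=
  sInf ((fun t : ℝ≥0 => (t : ℝ≥0∞)) '' {t : ℝ≥0 | X t ω = 0 ∨ X t ω = t + u})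

/-- `Q` is the measure `ℚ_{x,u}` on `C(ℝ₊)`: for all `t ≥ 0` and `A ∈ 𝓕_t`,
`Q(A) = 𝕎_x[φ₀(X_t, t + u) / φ₀(x, u) ; {T_u > t} ∩ A]`.
For `0 < x < u` the density is positive on `{T_u > t}` up to a `𝕎_x`-null set, since
`0 < X_t < t + u` there and `φ₀(y, s) > 0` for `0 < y < s`. -/
def IsConditionedMeasure (x u : ℝ) (W Q : Measure PathSpace) : Prop :=
  ∀ (t : ℝ≥0) (A : Set PathSpace), MeasurableSet[naturalFiltration t] A →
    Q A = ∫⁻ ω in {ω | (t : ℝ≥0∞) < exitTime u ω} ∩ A,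
      ENNReal.ofReal (phi 0 (X t ω) (t + u) / phi 0 x u) ∂W

end

end SpaceTimeBM

/-!
The proof rests on three facts about `φ_a`.

* **Heat equation.** Each term of the series for `φ_a(y, s)` is the image of the odd solution `g` of
  `g'' = -a² g` under the translation `y ↦ y + 2ks` with Girsanov factor `e^{-2(ky + k²s)}`. Hence
  `e^{a²s/2} φ_a(y, s)` is invariant under the heat semigroup (`integral_phi_add`), and
  `e^{a²t/2} φ_a(X_t, t + u)` is a martingale under Wiener measure
  (`IsWienerMeasure.martingale_harmonicProcess`).
* **Boundary values.** The images are arranged so that `φ_a` vanishes on both sides `y = 0` and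
  `y = s` of the wedge (`phi_zero_left`, `phi_self`).
* **Positivity.** `φ₀ > 0` inside the wedge (`phi_zero_pos`). Up to a positive factor `φ₀` is an odd
  theta kernel, and its functional equation covers the times at which the defining series is not
  dominated by few terms.

Since the martingale vanishes at the exit time, it remains a martingale when it is killed there
(`setIntegral_inter_lt_eq`). This form of optional stopping is proved by discretizing time: on the
event that the exit falls into a given grid interval, the terminal value may be replaced by the
value at the end of the interval wherever the latter is at most `1` in absolute value, and the
resulting integrands are dominated and tend to zero with the mesh.

Finally, on `𝓕_t` the conditioned measure has density `φ₀(X_t, t + u) / φ₀(x, u)` with respect to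
the killed Wiener measure, so that integrating `φ_a / φ₀` against it cancels the denominator and
leaves the killed martingale, up to the factor `e^{-a²t/2}`.
-/

namespace SpaceTimeBM

open Filter Topology Set

/-! ### The theta-type series -/

/-- The odd solution `g` of `g'' = -a² g` through which `φ_a` is built: a multiple of `sin (a w)`
for `a ≠ 0`, and its limit `w` for `a = 0`. -/
noncomputable def oddWeight (a w : ℝ) : ℝ :=
  if a = 0 then w else Real.pi / Real.sinh (a * Real.pi) * Real.sin (a * w)

/-- The `k`-th term of the series defining `φ_a(y, s)`. -/
noncomputable def phiTerm (a : ℝ) (k : ℤ) (y s : ℝ) : ℝ :=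
  oddWeight a (y + 2 * k * s) * Real.exp (-2 * (k * y + (k : ℝ) ^ 2 * s))

theorem phi_eq_tsum (a y s : ℝ) : phi a y s = ∑' k : ℤ, phiTerm a k y s := by
  unfold phi phiTerm oddWeight
  split_ifs with ha
  · rfl
  · rw [← tsum_mul_left]
    refine tsum_congr fun k => ?_
    rw [← mul_assoc, show a * (y + 2 * k * s) = a * y + 2 * k * a * s by ring]

theorem oddWeight_neg (a w : ℝ) : oddWeight a (-w) = -oddWeight a w := by
  unfold oddWeight
  split_ifs <;> simp

theorem continuous_oddWeight (a : ℝ) : Continuous (oddWeight a) := by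
  unfold oddWeight
  split_ifs <;> fun_prop

theorem exists_abs_oddWeight_le (a : ℝ) : ∃ C, 0 ≤ C ∧ ∀ w, |oddWeight a w| ≤ C * (1 + |w|) := by
  by_cases ha : a = 0
  · refine ⟨1, zero_le_one, fun w => ?_⟩
    simp [oddWeight, ha]
  · refine ⟨|Real.pi / Real.sinh (a * Real.pi)|, abs_nonneg _, fun w => ?_⟩
    simp only [oddWeight, ha, if_false, abs_mul]
    gcongr
    linarith [Real.abs_sin_le_one (a * w), abs_nonneg w]

theorem summable_linear_mul_exp (A B R : ℝ) {s : ℝ} (hs : 0 < s) :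
    Summable fun k : ℤ =>
      (A + B * |(k : ℝ)|) * Real.exp (2 * R * |(k : ℝ)| - 2 * s * (k : ℝ) ^ 2) := by
  have hT : 0 < 2 * s / Real.pi := by positivity
  have h0 := (summable_pow_mul_jacobiTheta₂_term_bound (R / Real.pi) hT 0).mul_left A
  have h1 := (summable_pow_mul_jacobiTheta₂_term_bound (R / Real.pi) hT 1).mul_left B
  refine (h0.add h1).congr fun k => ?_
  rw [show -Real.pi * (2 * s / Real.pi * (k : ℝ) ^ 2 - 2 * (R / Real.pi) * (|k| : ℤ))
    = 2 * R * |(k : ℝ)| - 2 * s * (k : ℝ) ^ 2 by push_cast; field_simp; ring]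
  push_cast
  ring

/-- A bound uniform over bounded `y` and `s₀ ≤ s ≤ s₁`, summable in `k` by
`summable_linear_mul_exp`. -/
theorem abs_phiTerm_le {a C : ℝ} (hC0 : 0 ≤ C) (hC : ∀ w, |oddWeight a w| ≤ C * (1 + |w|))
    {y s R s₀ s₁ : ℝ} (hy : |y| ≤ R) (hs₀ : 0 ≤ s₀) (h₀ : s₀ ≤ s) (h₁ : s ≤ s₁) (k : ℤ) :
    |phiTerm a k y s| ≤ (C * (1 + R) + C * (2 * s₁) * |(k : ℝ)|) *
      Real.exp (2 * R * |(k : ℝ)| - 2 * s₀ * (k : ℝ) ^ 2) := by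
  unfold phiTerm
  rw [abs_mul, Real.abs_exp]
  have hk := abs_nonneg (k : ℝ)
  have hky : -(k * y) ≤ R * |(k : ℝ)| := by
    calc -(k * y) ≤ |k * y| := neg_le_abs _
      _ = |y| * |(k : ℝ)| := by rw [abs_mul, mul_comm]
      _ ≤ _ := by gcongr
  refine mul_le_mul ((hC _).trans ?_) (Real.exp_le_exp.2 ?_) (Real.exp_pos _).le ?_
  · have : |y + 2 * k * s| ≤ R + 2 * s₁ * |(k : ℝ)| := by
      calc |y + 2 * k * s| ≤ |y| + |2 * k * s| := abs_add_le _ _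
        _ = |y| + 2 * s * |(k : ℝ)| := by
          rw [abs_mul, abs_mul, abs_of_nonneg (hs₀.trans h₀), abs_two]; ring
        _ ≤ _ := by gcongr
    calc C * (1 + |y + 2 * k * s|) ≤ C * (1 + (R + 2 * s₁ * |(k : ℝ)|)) := by gcongr
      _ = _ := by ring
  · have : s₀ * (k : ℝ) ^ 2 ≤ k ^ 2 * s := by rw [mul_comm]; gcongr
    linarith
  · have hR := (abs_nonneg y).trans hy
    have hs₁ := hs₀.trans (h₀.trans h₁)
    positivity

theorem summable_phiTerm (a y : ℝ) {s : ℝ} (hs : 0 < s) : Summable fun k => phiTerm a k y s := by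
  obtain ⟨C, hC0, hC⟩ := exists_abs_oddWeight_le a
  exact (summable_linear_mul_exp _ _ _ hs).of_norm_bounded
    (abs_phiTerm_le hC0 hC le_rfl hs.le le_rfl le_rfl)

theorem continuousOn_phi (a : ℝ) :
    ContinuousOn (fun p : ℝ × ℝ => phi a p.1 p.2) {p | 0 < p.2} := by
  obtain ⟨C, hC0, hC⟩ := exists_abs_oddWeight_le a
  rintro ⟨y, s⟩ (hs : 0 < s)
  have hU : Ioo (-(|y| + 1)) (|y| + 1) ×ˢ Ioo (s / 2) (s + 1) ∈ 𝓝 (y, s) := by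
    refine prod_mem_nhds (Ioo_mem_nhds ?_ ?_) (Ioo_mem_nhds ?_ ?_)
    · linarith [neg_abs_le y]
    · linarith [le_abs_self y]
    · linarith
    · linarith
  refine ContinuousAt.continuousWithinAt (ContinuousOn.continuousAt ?_ hU)
  simp only [phi_eq_tsum]
  refine continuousOn_tsum (fun k => ?_)
    (summable_linear_mul_exp (C * (1 + (|y| + 1))) (C * (2 * (s + 1))) (|y| + 1) (half_pos hs)) ?_
  · have := continuous_oddWeight a
    unfold phiTerm
    fun_prop
  · rintro k ⟨y', s'⟩ ⟨hy', hs'⟩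
    exact abs_phiTerm_le hC0 hC (abs_le.2 ⟨hy'.1.le, hy'.2.le⟩) (by positivity) hs'.1.le hs'.2.le k

theorem continuous_phi_left (a : ℝ) {s : ℝ} (hs : 0 < s) : Continuous fun y => phi a y s :=
  (continuousOn_phi a).comp_continuous (f := fun y => (y, s)) (by fun_prop) fun _ => hs

/-- The terms of index `k` and `-k` cancel on the boundary `y = 0`. -/
theorem phi_zero_left (a s : ℝ) : phi a 0 s = 0 := by
  have h : ∑' k : ℤ, phiTerm a k 0 s = -∑' k : ℤ, phiTerm a k 0 s := by
    conv_lhs => rw [← (Equiv.neg ℤ).tsum_eq]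
    rw [← tsum_neg]
    refine tsum_congr fun k => ?_
    simp only [phiTerm, Equiv.neg_apply, Int.cast_neg]
    rw [show (0 : ℝ) + 2 * -(k : ℝ) * s = -(0 + 2 * k * s) by ring, oddWeight_neg, neg_mul]
    congr 3
    ring
  rw [phi_eq_tsum]
  linarith

/-- The terms of index `k` and `-1 - k` cancel on the boundary `y = s`. -/
theorem phi_self (a s : ℝ) : phi a s s = 0 := by
  have h : ∑' k : ℤ, phiTerm a k s s = -∑' k : ℤ, phiTerm a k s s := by
    conv_lhs => rw [← (Equiv.subLeft (-1 : ℤ)).tsum_eq]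
    rw [← tsum_neg]
    refine tsum_congr fun k => ?_
    simp only [phiTerm, Equiv.subLeft_apply]
    push_cast
    rw [show s + 2 * (-1 - (k : ℝ)) * s = -(s + 2 * k * s) by ring, oddWeight_neg, neg_mul]
    congr 3
    ring
  rw [phi_eq_tsum]
  linarith

/-! ### The heat identity -/

theorem integral_exp_mul_gaussianReal (v : ℝ≥0) (θ : ℝ) :
    ∫ z, Real.exp (θ * z) ∂gaussianReal 0 v = Real.exp (v * θ ^ 2 / 2) := by
  have := congrFun (mgf_id_gaussianReal (μ := 0) (v := v)) θ
  simpa [mgf] using this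

/-- Exponential tilting translates a centred Gaussian measure. -/
theorem gaussianReal_tilted (v : ℝ≥0) (θ : ℝ) :
    (gaussianReal 0 v).tilted (fun z => θ * z) = gaussianReal (θ * v) v := by
  by_cases hv : v = 0
  · subst hv
    ext A hA
    rw [tilted_apply' _ _ hA]
    by_cases h0 : (0 : ℝ) ∈ A <;>
      simp [gaussianReal_zero_var, ← lintegral_indicator hA, lintegral_dirac' _ ((by fun_prop :
        Measurable fun z => ENNReal.ofReal (Real.exp (θ * z))).indicator hA),
        Measure.dirac_apply' _ hA, h0]
  rw [Measure.tilted, integral_exp_mul_gaussianReal, gaussianReal_of_var_ne_zero _ hv,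
    gaussianReal_of_var_ne_zero _ hv,
    ← withDensity_mul _ (measurable_gaussianPDF 0 v) (by fun_prop)]
  congr 1
  ext z
  have hv' : (v : ℝ) ≠ 0 := by exact_mod_cast hv
  simp only [Pi.mul_apply, gaussianPDF, gaussianPDFReal]
  rw [← ENNReal.ofReal_mul (by positivity), mul_assoc, ← Real.exp_sub, ← Real.exp_add]
  congr 3
  field_simp
  ring

theorem integrable_exp_mul_mul_gaussianReal_iff (v : ℝ≥0) (θ : ℝ) (f : ℝ → ℝ) :
    Integrable (fun z => Real.exp (θ * z) * f z) (gaussianReal 0 v) ↔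
      Integrable f (gaussianReal (θ * v) v) := by
  rw [← gaussianReal_tilted]
  exact (integrable_tilted_iff (integrable_exp_mul_gaussianReal θ) f).symm

theorem integral_exp_mul_mul_gaussianReal (v : ℝ≥0) (θ : ℝ) (f : ℝ → ℝ) :
    ∫ z, Real.exp (θ * z) * f z ∂gaussianReal 0 v =
      Real.exp (v * θ ^ 2 / 2) * ∫ z, f z ∂gaussianReal (θ * v) v := by
  rw [← gaussianReal_tilted, integral_tilted, integral_exp_mul_gaussianReal, ← integral_const_mul]
  refine integral_congr_ae (Eventually.of_forall fun z => ?_)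
  have := Real.exp_ne_zero (v * θ ^ 2 / 2)
  simp only [smul_eq_mul]
  field_simp

theorem integrable_abs_gaussianReal (m : ℝ) (v : ℝ≥0) :
    Integrable (fun z => |z|) (gaussianReal m v) :=
  ((memLp_id_gaussianReal 1).integrable le_rfl).abs

theorem integrable_oddWeight_add (a w m : ℝ) (v : ℝ≥0) :
    Integrable (fun z => oddWeight a (w + z)) (gaussianReal m v) := by
  obtain ⟨C, hC0, hC⟩ := exists_abs_oddWeight_le a
  refine (((integrable_const (1 + |w|)).add (integrable_abs_gaussianReal m v)).const_mul C).mono'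
    ((continuous_oddWeight a).comp (by fun_prop)).aestronglyMeasurable
    (Eventually.of_forall fun z => (hC _).trans ?_)
  simp only [Pi.add_apply]
  rw [add_assoc]
  gcongr
  exact abs_add_le w z

theorem integral_oddWeight_add (a w m : ℝ) (v : ℝ≥0) :
    ∫ z, oddWeight a (w + z) ∂gaussianReal m v =
      Real.exp (-(a ^ 2 / 2) * v) * oddWeight a (w + m) := by
  unfold oddWeight
  split_ifs with ha
  · have hid : Integrable (fun z : ℝ => z) (gaussianReal m v) :=
      (memLp_id_gaussianReal 1).integrable le_rfl
    rw [integral_add (integrable_const _) hid, integral_id_gaussianReal]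
    simp [ha]
  · rw [integral_const_mul]
    have hint : Integrable (fun z : ℝ => Complex.exp (a * z * Complex.I)) (gaussianReal m v) := by
      refine (integrable_const (1 : ℝ)).mono' (by fun_prop) (Eventually.of_forall fun z => ?_)
      rw [← Complex.ofReal_mul, Complex.norm_exp_ofReal_mul_I]
    have hchar : ∫ z : ℝ, Complex.exp (a * z * Complex.I) ∂gaussianReal m v =
        Complex.exp (a * m * Complex.I - v * a ^ 2 / 2) := by
      rw [← charFun_gaussianReal, charFun_apply_real]
    have key : ∫ z, Real.sin (a * (w + z)) ∂gaussianReal m v =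
        (Complex.exp (a * w * Complex.I) *
          ∫ z : ℝ, Complex.exp (a * z * Complex.I) ∂gaussianReal m v).im := by
      rw [← integral_const_mul]
      have h2 := integral_im (𝕜 := ℂ) (hint.const_mul (Complex.exp (a * w * Complex.I)))
      simp only [RCLike.im_to_complex] at h2
      rw [← h2]
      refine integral_congr_ae (Eventually.of_forall fun z => ?_)
      simp only
      rw [← Complex.exp_add, ← Complex.exp_ofReal_mul_I_im]
      push_cast
      ring_nf
    rw [key, hchar, ← Complex.exp_add,
      show (a * w * Complex.I + (a * m * Complex.I - v * a ^ 2 / 2) : ℂ) =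
        ((-(a ^ 2 / 2) * v : ℝ) : ℂ) + ((a * (w + m) : ℝ) : ℂ) * Complex.I by push_cast; ring,
      Complex.exp_add, ← Complex.ofReal_exp, Complex.im_ofReal_mul,
      Complex.exp_ofReal_mul_I_im]
    ring

theorem phiTerm_add (a : ℝ) (k : ℤ) (y z s : ℝ) :
    phiTerm a k (y + z) s = Real.exp (-2 * (k * y + (k : ℝ) ^ 2 * s)) *
      (Real.exp (-2 * k * z) * oddWeight a (y + 2 * k * s + z)) := by
  unfold phiTerm
  rw [← mul_assoc, ← Real.exp_add, mul_comm]
  congr 2 <;> ring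

theorem integrable_phiTerm_add (a : ℝ) (k : ℤ) (y s : ℝ) (v : ℝ≥0) :
    Integrable (fun z => phiTerm a k (y + z) s) (gaussianReal 0 v) := by
  simp only [phiTerm_add]
  exact ((integrable_exp_mul_mul_gaussianReal_iff v _ _).2
    (integrable_oddWeight_add a _ _ v)).const_mul _

/-- Each term `e^{a²s/2} phiTerm a k y s` is a solution of the backward heat equation: the Gaussian
average is computed by the translation that the exponential factor induces. -/
theorem integral_phiTerm_add (a : ℝ) (k : ℤ) (y s : ℝ) (v : ℝ≥0) :
    ∫ z, phiTerm a k (y + z) (s + v) ∂gaussianReal 0 v =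
      Real.exp (-(a ^ 2 / 2) * v) * phiTerm a k y s := by
  simp only [phiTerm_add]
  rw [integral_const_mul, integral_exp_mul_mul_gaussianReal, integral_oddWeight_add, phiTerm,
    ← mul_assoc, ← Real.exp_add,
    show y + 2 * k * (s + v) + -2 * k * v = y + 2 * k * s by ring]
  rw [show -2 * (k * y + (k : ℝ) ^ 2 * (s + v)) + v * (-2 * (k : ℝ)) ^ 2 / 2 =
    -2 * (k * y + (k : ℝ) ^ 2 * s) by ring]
  ring

/-- After tilting, the average of `|phiTerm|` at time `s + v` decays in `k` as `|phiTerm|` at time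
`s` does; this is what allows the series to be averaged term by term. -/
theorem integral_abs_phiTerm_add_le {a C : ℝ} (hC0 : 0 ≤ C)
    (hC : ∀ w, |oddWeight a w| ≤ C * (1 + |w|)) (k : ℤ) (y : ℝ) {s : ℝ} (hs : 0 ≤ s) (v : ℝ≥0) :
    ∫ z, |phiTerm a k (y + z) (s + v)| ∂gaussianReal 0 v ≤
      (C * (1 + |y| + ∫ z, |z| ∂gaussianReal 0 v) + C * (2 * s) * |(k : ℝ)|) *
        Real.exp (2 * |y| * |(k : ℝ)| - 2 * s * (k : ℝ) ^ 2) := by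
  set m := ∫ z, |z| ∂gaussianReal 0 v
  -- the Gaussian measure of mean `-2kv` is recentred to make the first moment independent of `k`
  have hshift (f : ℝ → ℝ) (hf : Continuous f) :
      ∫ z, f z ∂gaussianReal (-2 * k * v) v = ∫ z, f (z + -2 * k * v) ∂gaussianReal 0 v := by
    have h := gaussianReal_map_add_const (μ := 0) (v := v) (-2 * k * v)
    rw [zero_add] at h
    rw [← h, integral_map (by fun_prop) hf.aestronglyMeasurable]
  have habs (z : ℝ) : |phiTerm a k (y + z) (s + v)| =
      Real.exp (-2 * (k * y + (k : ℝ) ^ 2 * (s + v))) *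
        (Real.exp (-2 * k * z) * |oddWeight a (y + 2 * k * (s + v) + z)|) := by
    rw [phiTerm_add, abs_mul, abs_mul, Real.abs_exp, Real.abs_exp]
  have hw := continuous_oddWeight a
  simp only [habs]
  rw [integral_const_mul, integral_exp_mul_mul_gaussianReal, ← mul_assoc, ← Real.exp_add,
    hshift (fun z => |oddWeight a (y + 2 * k * (s + v) + z)|) (hw.comp (by fun_prop)).abs,
    mul_comm]
  have hk := abs_nonneg (k : ℝ)
  gcongr
  · calc ∫ z, |oddWeight a (y + 2 * k * (s + v) + (z + -2 * k * v))| ∂gaussianReal 0 v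
        ≤ ∫ z, (C * (1 + |y| + 2 * s * |(k : ℝ)|) + C * |z|) ∂gaussianReal 0 v := by
          refine integral_mono_of_nonneg (Eventually.of_forall fun _ => abs_nonneg _)
            ((integrable_const _).add ((integrable_abs_gaussianReal 0 v).const_mul C))
            (Eventually.of_forall fun z => (hC _).trans ?_)
          rw [show y + 2 * k * (s + v) + (z + -2 * k * v) = y + 2 * s * k + z by ring]
          change _ ≤ C * (1 + |y| + 2 * s * |(k : ℝ)|) + C * |z|
          rw [← mul_add]
          refine mul_le_mul_of_nonneg_left ?_ hC0
          have h1 := abs_add_le (y + 2 * s * k) z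
          have h2 := abs_add_le y (2 * s * k)
          rw [abs_mul, abs_of_nonneg (show 0 ≤ 2 * s by positivity)] at h2
          linarith
      _ = C * (1 + |y| + m) + C * (2 * s) * |(k : ℝ)| := by
          rw [integral_add (integrable_const _) ((integrable_abs_gaussianReal 0 v).const_mul C),
            integral_const_mul C fun z => |z|]
          simp only [integral_const, probReal_univ, one_smul]
          ring
  · have hky : -(k * y) ≤ |y| * |(k : ℝ)| := by
      rw [← abs_mul, mul_comm]; exact neg_le_abs _
    linarith

theorem summable_integral_norm_phiTerm_add (a y : ℝ) {s : ℝ} (hs : 0 < s) (v : ℝ≥0) :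
    Summable fun k : ℤ => ∫ z, ‖phiTerm a k (y + z) (s + v)‖ ∂gaussianReal 0 v := by
  obtain ⟨C, hC0, hC⟩ := exists_abs_oddWeight_le a
  exact (summable_linear_mul_exp _ _ _ hs).of_nonneg_of_le
    (fun k => integral_nonneg fun z => norm_nonneg _)
    fun k => integral_abs_phiTerm_add_le hC0 hC k y hs.le v

theorem integrable_phi_add (a y : ℝ) {s : ℝ} (hs : 0 < s) (v : ℝ≥0) :
    Integrable (fun z => phi a (y + z) (s + v)) (gaussianReal 0 v) := by
  have hsv : 0 < s + v := by positivity
  refine ⟨((continuous_phi_left a hsv).comp (by fun_prop)).aestronglyMeasurable, ?_⟩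
  have hi (k : ℤ) := integrable_phiTerm_add a k y (s + v) v
  have hle (z : ℝ) : ‖phi a (y + z) (s + v)‖ₑ ≤ ∑' k : ℤ, ‖phiTerm a k (y + z) (s + v)‖ₑ := by
    rw [phi_eq_tsum]
    exact enorm_tsum_le_tsum_enorm
  refine (lintegral_mono hle).trans_lt ?_
  rw [lintegral_tsum fun k => (hi k).1.enorm]
  have h (k : ℤ) : ∫⁻ z, ‖phiTerm a k (y + z) (s + v)‖ₑ ∂gaussianReal 0 v =
      ENNReal.ofReal (∫ z, ‖phiTerm a k (y + z) (s + v)‖ ∂gaussianReal 0 v) :=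
    (ofReal_integral_norm_eq_lintegral_enorm (hi k)).symm
  simp only [h]
  exact (summable_integral_norm_phiTerm_add a y hs v).tsum_ofReal_lt_top

/-- `e^{a²s/2} φ_a(y, s)` is invariant under the heat semigroup. -/
theorem integral_phi_add (a y : ℝ) {s : ℝ} (hs : 0 < s) (v : ℝ≥0) :
    ∫ z, phi a (y + z) (s + v) ∂gaussianReal 0 v = Real.exp (-(a ^ 2 / 2) * v) * phi a y s := by
  simp only [phi_eq_tsum]
  rw [← integral_tsum_of_summable_integral_norm (fun k => integrable_phiTerm_add a k y (s + v) v)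
    (summable_integral_norm_phiTerm_add a y hs v), ← tsum_mul_left]
  exact tsum_congr fun k => integral_phiTerm_add a k y s v

/-! ### Positivity of `φ₀` -/

theorem phiTerm_zero (k : ℤ) (y s : ℝ) :
    phiTerm 0 k y s = (y + 2 * k * s) * Real.exp (-2 * (k * y + (k : ℝ) ^ 2 * s)) := by
  simp [phiTerm, oddWeight]

/-- Completing the square: up to a positive factor, `φ₀` is the odd theta kernel. -/
theorem phi_zero_eq_oddKernel (y : ℝ) {s : ℝ} (hs : 0 < s) :
    phi 0 y s = 2 * s * Real.exp (y ^ 2 / (2 * s)) *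
      HurwitzZeta.oddKernel (↑(y / (2 * s)) : UnitAddCircle) (2 * s / Real.pi) := by
  have h := HurwitzZeta.hasSum_int_oddKernel (y / (2 * s)) (x := 2 * s / Real.pi) (by positivity)
  rw [← (h.mul_left (2 * s * Real.exp (y ^ 2 / (2 * s)))).tsum_eq, phi_eq_tsum]
  refine tsum_congr fun k => ?_
  rw [phiTerm_zero, mul_mul_mul_comm, ← Real.exp_add]
  congr 2
  · field_simp
    ring
  · field_simp
    ring

theorem abs_sin_nat_mul_le (n : ℕ) (ψ : ℝ) : |Real.sin (n * ψ)| ≤ n * |Real.sin ψ| := by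
  induction n with
  | zero => simp
  | succ n ih =>
    push_cast
    rw [add_mul, one_mul, Real.sin_add, add_mul, one_mul]
    calc |Real.sin (n * ψ) * Real.cos ψ + Real.cos (n * ψ) * Real.sin ψ|
        ≤ |Real.sin (n * ψ)| * |Real.cos ψ| + |Real.cos (n * ψ)| * |Real.sin ψ| := by
          rw [← abs_mul, ← abs_mul]; exact abs_add_le _ _
      _ ≤ |Real.sin (n * ψ)| * 1 + 1 * |Real.sin ψ| := by
          gcongr <;> exact Real.abs_cos_le_one _
      _ ≤ n * |Real.sin ψ| + |Real.sin ψ| := by linarith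

theorem sq_le_geometric (n : ℕ) : ((n : ℝ) + 2) ^ 2 ≤ 4 * (9 / 4) ^ n := by
  induction n with
  | zero => norm_num
  | succ n ih =>
    rw [pow_succ (9 / 4 : ℝ)]
    push_cast
    have hn : (0 : ℝ) ≤ n := n.cast_nonneg
    nlinarith

/-- The first mode dominates the sine series when the time parameter is bounded below. -/
theorem sinKernel_pos {α τ : ℝ} (hα0 : 0 < α) (hα1 : α < 1 / 2) (hτ : 2 / 3 ≤ Real.pi * τ) :
    0 < HurwitzZeta.sinKernel (α : UnitAddCircle) τ := by
  have hτ0 : 0 < τ := pos_of_mul_pos_right (by linarith) Real.pi_pos.le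
  set ψ := 2 * Real.pi * α
  set c := Real.pi * τ
  have hψ : 0 < Real.sin ψ := by
    have := Real.pi_pos
    exact Real.sin_pos_of_pos_of_lt_pi (by positivity) (by simp only [ψ]; nlinarith)
  set f : ℕ → ℝ := fun n => 2 * n * Real.sin (2 * Real.pi * α * n) *
    Real.exp (-Real.pi * n ^ 2 * τ) with hf
  have hsum : HasSum f (HurwitzZeta.sinKernel (α : UnitAddCircle) τ) :=
    HurwitzZeta.hasSum_nat_sinKernel α hτ0
  have htail := (hasSum_nat_add_iff' 2).2 hsum
  have hf1 : f 1 = 2 * Real.sin ψ * Real.exp (-c) := by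
    simp only [hf, ψ, c]
    push_cast
    ring_nf
  rw [Finset.sum_range_succ, Finset.sum_range_one, hf1, show f 0 = 0 by simp [hf], zero_add]
    at htail
  -- the majorant of the tail is geometric of ratio `9q/4`, and it is smaller than the first mode
  -- because `4q < 1 - 9q/4` for `q < 4/25`
  set q := Real.exp (-(3 * c))
  have hq0 : 0 < q := Real.exp_pos _
  have hq : q < 4 / 25 := by
    calc q ≤ Real.exp (-2) := Real.exp_le_exp.2 (by linarith)
      _ = (Real.exp 1 ^ 2)⁻¹ := by rw [Real.exp_neg, ← Real.exp_nat_mul]; norm_num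
      _ < (25 / 4)⁻¹ := by
        have := Real.exp_one_gt_d9
        gcongr
        nlinarith
      _ = _ := by norm_num
  have hbound (n : ℕ) : -(2 * Real.sin ψ * Real.exp (-c) * (4 * q)) * (9 / 4 * q) ^ n ≤
      f (n + 2) := by
    have hn : (0 : ℝ) ≤ n := n.cast_nonneg
    have hsin := abs_sin_nat_mul_le (n + 2) ψ
    rw [abs_of_pos hψ] at hsin
    have hexp : Real.exp (-Real.pi * ((n + 2 : ℕ) : ℝ) ^ 2 * τ) ≤
        Real.exp (-c) * (q * q ^ n) := by
      rw [← pow_succ', ← Real.exp_nat_mul, ← Real.exp_add]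
      refine Real.exp_le_exp.2 ?_
      have hc : 0 < c := by linarith
      have : -Real.pi * ((n + 2 : ℕ) : ℝ) ^ 2 * τ = -(c * (n + 2) ^ 2) := by
        simp only [c]; push_cast; ring
      rw [this]
      push_cast
      nlinarith [mul_nonneg hc.le (mul_nonneg hn hn), mul_nonneg hc.le hn]
    have h1 : |f (n + 2)| ≤ 2 * Real.sin ψ * Real.exp (-c) * (4 * q) * (9 / 4 * q) ^ n := by
      calc |f (n + 2)| = 2 * (n + 2 : ℕ) * |Real.sin ((n + 2 : ℕ) * ψ)| *
            Real.exp (-Real.pi * ((n + 2 : ℕ) : ℝ) ^ 2 * τ) := by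
            simp only [hf, ψ]
            rw [abs_mul, abs_mul, Real.abs_exp, abs_of_nonneg (by positivity : (0 : ℝ) ≤
              2 * (n + 2 : ℕ)), mul_comm (2 * Real.pi * α)]
        _ ≤ 2 * (n + 2 : ℕ) * ((n + 2 : ℕ) * Real.sin ψ) * (Real.exp (-c) * (q * q ^ n)) := by
            gcongr
        _ = 2 * Real.sin ψ * Real.exp (-c) * (((n : ℝ) + 2) ^ 2) * (q * q ^ n) := by
            push_cast; ring
        _ ≤ 2 * Real.sin ψ * Real.exp (-c) * (4 * (9 / 4) ^ n) * (q * q ^ n) := by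
            gcongr
            exact sq_le_geometric n
        _ = _ := by rw [mul_pow]; ring
    linarith [neg_abs_le (f (n + 2))]
  have hgeo := (hasSum_geometric_of_lt_one (r := 9 / 4 * q) (by positivity) (by linarith)).mul_left
    (-(2 * Real.sin ψ * Real.exp (-c) * (4 * q)))
  have hle := hasSum_le hbound hgeo htail
  have hpos : 0 < 2 * Real.sin ψ * Real.exp (-c) := by positivity
  have h4 : 4 * q * (1 - 9 / 4 * q)⁻¹ < 1 := by
    rw [← div_eq_mul_inv, div_lt_one (by linarith)]
    linarith
  nlinarith

theorem phi_zero_pos_of_le {y s : ℝ} (hy : 0 < y) (hys : y < s) (hs : s ≤ 6) : 0 < phi 0 y s := by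
  have hs0 : 0 < s := hy.trans hys
  have hpi := Real.pi_gt_three
  rw [phi_zero_eq_oddKernel y hs0, HurwitzZeta.oddKernel_functional_equation]
  have : 0 < HurwitzZeta.sinKernel (↑(y / (2 * s)) : UnitAddCircle) (1 / (2 * s / Real.pi)) := by
    refine sinKernel_pos (by positivity) ?_ ?_
    · rw [div_lt_div_iff₀ (by positivity) (by norm_num)]
      linarith
    · rw [one_div_div, ← mul_div_assoc, div_le_div_iff₀ (by norm_num) (by positivity)]
      nlinarith
  positivity

/-- For `y ≥ 1` the term of index `n ≥ 0` outweighs that of index `-(n + 1)`, its mirror image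
with respect to the boundary `y = s`. -/
theorem phiTerm_add_phiTerm_neg_add_one_pos (n : ℕ) {y s : ℝ} (hy : 1 ≤ y) (hys : y < s) :
    0 < phiTerm 0 n y s + phiTerm 0 (-(n + 1)) y s := by
  have hn : (0 : ℝ) ≤ n := n.cast_nonneg
  -- the linear factors of the two terms are `b` and `-(b + d)`
  set b := y + 2 * n * s with hb
  have hb1 : 1 ≤ b := by
    have : 0 ≤ 2 * n * s := by have := hy.trans hys.le; positivity
    linarith
  set d := 2 * (s - y) with hd
  have hd0 : 0 < d := by linarith
  have hlt : b + d < b * Real.exp (d / b) := by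
    have h := Real.add_one_lt_exp (x := d / b) (by positivity)
    calc b + d = b * (d / b + 1) := by field_simp; ring
      _ < _ := by gcongr
  have hexp : Real.exp (d / b) ≤ Real.exp (d * (2 * n + 1)) := by
    refine Real.exp_le_exp.2 ?_
    rw [div_le_iff₀ (by linarith), mul_assoc]
    refine le_mul_of_one_le_right hd0.le ?_
    nlinarith
  have hlt' : b + d < b * Real.exp (d * (2 * n + 1)) := hlt.trans_le (by gcongr)
  rw [phiTerm_zero, phiTerm_zero]
  push_cast
  rw [show -2 * (n * y + (n : ℝ) ^ 2 * s) =
    d * (2 * n + 1) + -2 * (-((n : ℝ) + 1) * y + (-((n : ℝ) + 1)) ^ 2 * s) by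
      simp only [hd]; ring, Real.exp_add, ← mul_assoc, ← add_mul,
    show y + 2 * -((n : ℝ) + 1) * s = -(b + d) by simp only [hb, hd]; ring]
  have := Real.exp_pos (-2 * (-((n : ℝ) + 1) * y + (-((n : ℝ) + 1)) ^ 2 * s))
  exact mul_pos (by linarith) this

theorem phi_zero_pos_of_one_le {y s : ℝ} (hy : 1 ≤ y) (hys : y < s) : 0 < phi 0 y s := by
  have h := (summable_phiTerm 0 y (by linarith : 0 < s)).hasSum.nat_add_neg_add_one
  rw [← phi_eq_tsum] at h
  rw [← h.tsum_eq]
  exact h.summable.tsum_pos (fun n => (phiTerm_add_phiTerm_neg_add_one_pos n hy hys).le) 0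
    (phiTerm_add_phiTerm_neg_add_one_pos 0 hy hys)

/-- For `y < 1` and large `s` the terms of index `k` and `-k` together are a small multiple of `y`,
the term of index `0`. -/
theorem phiTerm_add_phiTerm_neg_ge {k y s : ℝ} (hk : 1 ≤ k) (hy : 0 < y) (hy1 : y < 1)
    (hs : 6 ≤ s) :
    -(y * (8 * Real.exp (-1))) * Real.exp (-4 * k) ≤
      (y + 2 * k * s) * Real.exp (-2 * (k * y + k ^ 2 * s)) +
        (y - 2 * k * s) * Real.exp (-2 * (-k * y + k ^ 2 * s)) := by
  have hE (σ : ℝ) : Real.exp (-2 * (σ * y + k ^ 2 * s)) =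
      Real.exp (-2 * (σ * y)) * Real.exp (-2 * (k ^ 2 * s)) := by
    rw [← Real.exp_add]; ring_nf
  rw [hE, hE]
  set e := Real.exp (-2 * (k ^ 2 * s)) with he
  set A := Real.exp (-2 * (-k * y)) with hA
  have hAB : A * (1 - 4 * k * y) ≤ Real.exp (-2 * (k * y)) := by
    have h := Real.add_one_le_exp (-4 * k * y)
    calc A * (1 - 4 * k * y) ≤ A * Real.exp (-4 * k * y) := by
          gcongr
          linarith
      _ = _ := by rw [hA, ← Real.exp_add]; ring_nf
  have hA2 : A ≤ Real.exp (2 * k) := Real.exp_le_exp.2 (by nlinarith)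
  have hks : k ^ 2 * s ≤ Real.exp (k ^ 2 * s - 1) := by
    linarith [Real.add_one_le_exp (k ^ 2 * s - 1)]
  have hmain : k ^ 2 * s * (A * e) ≤ Real.exp (-1) * Real.exp (-4 * k) := by
    calc k ^ 2 * s * (A * e) ≤ Real.exp (k ^ 2 * s - 1) * (Real.exp (2 * k) * e) := by gcongr
      _ = Real.exp (2 * k - k ^ 2 * s - 1) := by
        rw [he, ← Real.exp_add, ← Real.exp_add]; ring_nf
      _ ≤ Real.exp (-1 + -4 * k) := Real.exp_le_exp.2 (by nlinarith)
      _ = _ := Real.exp_add _ _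
  have h1 : 2 * k * s * (A * (1 - 4 * k * y)) ≤ 2 * k * s * Real.exp (-2 * (k * y)) := by gcongr
  have h2 : 0 < y * Real.exp (-2 * (k * y)) := by positivity
  have h3 : 0 < y * A := by positivity
  have h4 : -(8 * y * (k ^ 2 * s)) * A ≤
      (y + 2 * k * s) * Real.exp (-2 * (k * y)) + (y - 2 * k * s) * A := by linarith
  have h5 := mul_le_mul_of_nonneg_right h4 (Real.exp_pos (-2 * (k ^ 2 * s))).le
  have h6 := mul_le_mul_of_nonneg_left hmain (by positivity : 0 ≤ 8 * y)
  rw [← he] at h5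
  linarith

theorem phi_zero_pos_of_lt_one {y s : ℝ} (hy : 0 < y) (hy1 : y < 1) (hs : 6 ≤ s) :
    0 < phi 0 y s := by
  have h := (summable_phiTerm 0 y (by linarith : 0 < s)).hasSum.nat_add_neg
  rw [← phi_eq_tsum] at h
  have htail := (hasSum_nat_add_iff' 1).2 h
  have h0 : phiTerm 0 0 y s = y := by simp [phiTerm_zero]
  simp only [Finset.range_one, Finset.sum_singleton, Nat.cast_zero, neg_zero, h0] at htail
  have hr : Real.exp (-4) < 1 / 16 := by
    calc Real.exp (-4) = (Real.exp 1 ^ 4)⁻¹ := by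
          rw [Real.exp_neg, ← Real.exp_nat_mul]; norm_num
      _ < (2 ^ 4)⁻¹ := by
        have := Real.exp_one_gt_d9
        gcongr
        linarith
      _ = _ := by norm_num
  have hr1 : Real.exp (-1) ≤ 1 := Real.exp_le_one_iff.2 (by norm_num)
  have hr0 := Real.exp_pos (-4)
  have hgeo := (hasSum_geometric_of_lt_one hr0.le (by linarith)).mul_left
    (-(y * (8 * Real.exp (-1))) * Real.exp (-4))
  have hle := hasSum_le (fun n => ?_) hgeo htail
  · have h8 : 8 * Real.exp (-1) * Real.exp (-4) * (1 - Real.exp (-4))⁻¹ < 1 := by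
      rw [← div_eq_mul_inv, div_lt_one (by linarith)]
      nlinarith
    nlinarith
  · have h := phiTerm_add_phiTerm_neg_ge (k := n + 1) (by linarith [n.cast_nonneg (α := ℝ)])
      hy hy1 hs
    simp only [phiTerm_zero]
    push_cast
    rw [mul_assoc _ (Real.exp (-4)), ← Real.exp_nat_mul, ← Real.exp_add,
      show -4 + (n : ℝ) * -4 = -4 * (n + 1) by ring, neg_sq,
      show y + 2 * -((n : ℝ) + 1) * s = y - 2 * (n + 1) * s by ring]
    exact h

/-- In the wedge `0 < y < s` the function `φ₀` is positive. For large `s` this is seen on the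
defining series; for small `s` on its Poisson dual, a sine series dominated by its first mode. -/
theorem phi_zero_pos {y s : ℝ} (hy : 0 < y) (hys : y < s) : 0 < phi 0 y s := by
  rcases le_or_gt 1 y with h1 | h1
  · exact phi_zero_pos_of_one_le h1 hys
  rcases le_total s 6 with h | h
  · exact phi_zero_pos_of_le hy hys h
  · exact phi_zero_pos_of_lt_one hy h1 h

/-! ### The martingale under Wiener measure -/

/-- The space-time harmonic process `e^{a²t/2} φ_a(X_t, t + u)`. -/
noncomputable def harmonicProcess (a u : ℝ) (t : ℝ≥0) (ω : PathSpace) : ℝ :=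
  Real.exp (a ^ 2 / 2 * t) * phi a (X t ω) (t + u)

theorem measurable_X_naturalFiltration (t : ℝ≥0) : Measurable[naturalFiltration t] (X t) :=
  (Filtration.stronglyAdapted_natural fun t => (measurable_X t).stronglyMeasurable).adapted t

theorem continuous_X_path (ω : PathSpace) : Continuous fun t => X t ω := ω.2

theorem measurable_phi_X (a : ℝ) {u : ℝ} (hu : 0 < u) (t : ℝ≥0) :
    Measurable[naturalFiltration t] fun ω => phi a (X t ω) (t + u) :=
  (continuous_phi_left a (by positivity)).measurable.comp (measurable_X_naturalFiltration t)

theorem measurable_harmonicProcess (a : ℝ) {u : ℝ} (hu : 0 < u) (t : ℝ≥0) :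
    Measurable[naturalFiltration t] (harmonicProcess a u t) :=
  (measurable_phi_X a hu t).const_mul _

theorem continuous_harmonicProcess_path (a : ℝ) {u : ℝ} (hu : 0 < u) (ω : PathSpace) :
    Continuous fun t => harmonicProcess a u t ω := by
  have h := (continuousOn_phi a).comp_continuous
    (f := fun t : ℝ≥0 => (X t ω, (t : ℝ) + u))
    ((continuous_X_path ω).prodMk (by fun_prop)) fun t => show 0 < (t : ℝ) + u by positivity
  exact (by fun_prop : Continuous fun t : ℝ≥0 => Real.exp (a ^ 2 / 2 * t)).mul h

theorem IsWienerMeasure.isProbabilityMeasure {x : ℝ} {W : Measure PathSpace}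
    (hW : IsWienerMeasure x W) : IsProbabilityMeasure W :=
  hW.isGaussianProcess.isProbabilityMeasure

theorem IsWienerMeasure.ae_X_zero {x : ℝ} {W : Measure PathSpace} (hW : IsWienerMeasure x W) :
    ∀ᵐ ω ∂W, X 0 ω = x := by
  filter_upwards [hW.eval_zero_ae_eq_zero] with ω h
  linarith

theorem IsWienerMeasure.map_increment {x : ℝ} {W : Measure PathSpace} (hW : IsWienerMeasure x W)
    (r v : ℝ≥0) : W.map (fun ω => X (r + v) ω - X r ω) = gaussianReal 0 v := by
  have h := ((hW.toIsPreBrownianReal.shift r).hasLaw_eval v).map_eq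
  simpa using h

theorem IsWienerMeasure.integrable_phi {x : ℝ} {W : Measure PathSpace} (hW : IsWienerMeasure x W)
    (a : ℝ) {u : ℝ} (hu : 0 < u) (t : ℝ≥0) : Integrable (fun ω => phi a (X t ω) (t + u)) W := by
  have hlaw : W.map (fun ω => X t ω - x) = gaussianReal 0 t :=
    (hW.toIsPreBrownianReal.hasLaw_eval t).map_eq
  have h := integrable_phi_add a x hu t
  rw [← hlaw] at h
  have h2 := h.comp_measurable ((measurable_X t).sub_const x)
  refine h2.congr (Eventually.of_forall fun ω => ?_)
  simp [add_comm u]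

/-- The Markov property at time `r` together with the heat identity. -/
theorem IsWienerMeasure.setIntegral_phi_add {x : ℝ} {W : Measure PathSpace}
    (hW : IsWienerMeasure x W) (a : ℝ) {u : ℝ} (hu : 0 < u) (r v : ℝ≥0) {A : Set PathSpace}
    (hA : MeasurableSet[naturalFiltration r] A) :
    ∫ ω in A, phi a (X (r + v) ω) ((r + v : ℝ≥0) + u) ∂W =
      Real.exp (-(a ^ 2 / 2) * v) * ∫ ω in A, phi a (X r ω) (r + u) ∂W := by
  have := hW.isProbabilityMeasure
  have hAm : MeasurableSet A := naturalFiltration.le r A hA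
  have hru : 0 < (r : ℝ) + u := by positivity
  rw [naturalFiltration, Filtration.natural_eq_comap] at hA
  obtain ⟨S, hS, rfl⟩ := hA
  -- `A` and `X r` are functions of the path up to time `r`, the increment is independent of it
  set past : PathSpace → (Iic r → ℝ) := fun ω i => X i ω - x
  set Z : PathSpace → ℝ := fun ω => X (r + v) ω - X r ω
  set ψ : (Iic r → ℝ) → ℝ × ℝ := fun p =>
    (p ⟨r, self_mem_Iic⟩ + x, S.indicator (fun _ => (1 : ℝ)) fun i => p i + x)
  have hψ : Measurable ψ := by
    refine Measurable.prodMk (by fun_prop) ?_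
    exact (measurable_const.indicator hS).comp (by fun_prop)
  set A := (fun (ω : PathSpace) (j : Iic r) => X j ω) ⁻¹' S
  have hVeq (ω : PathSpace) : ψ (past ω) = (X r ω, A.indicator (fun _ => (1 : ℝ)) ω) := by
    simp only [ψ, past, A, sub_add_cancel]
    rfl
  have hV : Measurable fun ω => (X r ω, A.indicator (fun _ => (1 : ℝ)) ω) :=
    (measurable_X r).prodMk (measurable_const.indicator hAm)
  have hZ : Measurable Z := (measurable_X _).sub (measurable_X _)
  have hind : IndepFun (fun ω => (X r ω, A.indicator (fun _ => (1 : ℝ)) ω)) Z W := by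
    have h := (hW.toIsPreBrownianReal.indepFun_shift r).symm.comp hψ (measurable_pi_apply v)
    refine h.congr (Eventually.of_forall hVeq) (Eventually.of_forall fun ω => ?_)
    simp [Z]
  have hmap := hind.map_prod_eq_prod_map_map hV.aemeasurable hZ.aemeasurable
  rw [hW.map_increment r v] at hmap
  set F : (ℝ × ℝ) × ℝ → ℝ := fun p => p.1.2 * phi a (p.1.1 + p.2) (r + u + v) with hF
  have hFc : Continuous F := by
    have := (continuous_phi_left a (by positivity : 0 < (r : ℝ) + u + v))
    exact (by fun_prop : Continuous fun p : (ℝ × ℝ) × ℝ => p.1.2).mul (this.comp (by fun_prop))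
  have hcomp (ω : PathSpace) : F ((X r ω, A.indicator (fun _ => (1 : ℝ)) ω), Z ω) =
      A.indicator (fun ω => phi a (X (r + v) ω) ((r + v : ℝ≥0) + u)) ω := by
    by_cases hω : ω ∈ A
    · simp [hF, Z, hω, add_right_comm]
    · simp [hF, hω]
  have hint : Integrable F (W.map fun ω => ((X r ω, A.indicator (fun _ => (1 : ℝ)) ω), Z ω)) := by
    rw [integrable_map_measure hFc.aestronglyMeasurable (hV.prodMk hZ).aemeasurable]
    refine ((hW.integrable_phi a hu (r + v)).indicator hAm).congr ?_
    exact Eventually.of_forall fun ω => (hcomp ω).symm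
  have h1 : ∫ ω in A, phi a (X (r + v) ω) ((r + v : ℝ≥0) + u) ∂W =
      ∫ p, F p ∂(W.map fun ω => ((X r ω, A.indicator (fun _ => (1 : ℝ)) ω), Z ω)) := by
    rw [integral_map (hV.prodMk hZ).aemeasurable hFc.aestronglyMeasurable,
      ← integral_indicator hAm]
    exact integral_congr_ae (Eventually.of_forall fun ω => (hcomp ω).symm)
  rw [hmap] at h1 hint
  rw [h1, integral_prod _ hint]
  simp only [hF, integral_const_mul, integral_phi_add a _ hru v]
  rw [integral_map hV.aemeasurable, ← integral_const_mul, ← integral_indicator hAm]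
  · refine integral_congr_ae (Eventually.of_forall fun ω => ?_)
    by_cases hω : ω ∈ A <;> simp [hω]
  · have := continuous_phi_left a hru
    exact (continuous_snd.mul (continuous_const.mul (this.comp continuous_fst))).aestronglyMeasurable

theorem IsWienerMeasure.martingale_harmonicProcess {x : ℝ} {W : Measure PathSpace}
    (hW : IsWienerMeasure x W) (a : ℝ) {u : ℝ} (hu : 0 < u) :
    Martingale (harmonicProcess a u) naturalFiltration W := by
  have := hW.isProbabilityMeasure
  have hint (t : ℝ≥0) : Integrable (harmonicProcess a u t) W :=
    (hW.integrable_phi a hu t).const_mul _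
  have hmeas (t : ℝ≥0) : StronglyMeasurable[naturalFiltration t] (harmonicProcess a u t) :=
    (measurable_harmonicProcess a hu t).stronglyMeasurable
  refine ⟨hmeas, fun r s hrs => ?_⟩
  obtain ⟨v, rfl⟩ := exists_add_of_le hrs
  refine (ae_eq_condExp_of_forall_setIntegral_eq (naturalFiltration.le r) (hint _)
    (fun _ _ _ => (hint r).integrableOn) (fun A hA _ => ?_) (hmeas r).aestronglyMeasurable).symm
  simp only [harmonicProcess]
  rw [integral_const_mul, integral_const_mul, hW.setIntegral_phi_add a hu r v hA, ← mul_assoc,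
    ← Real.exp_add]
  congr 2
  push_cast
  ring

/-! ### The exit time -/

theorem hit_iff (u : ℝ) (t : ℝ≥0) (ω : PathSpace) :
    X t ω = 0 ∨ X t ω = t + u ↔ X t ω * (X t ω - (t + u)) = 0 := by
  rw [mul_eq_zero, sub_eq_zero]

theorem continuous_hit (u : ℝ) (ω : PathSpace) :
    Continuous fun t : ℝ≥0 => X t ω * (X t ω - (t + u)) := by
  have := continuous_X_path ω
  fun_prop

theorem lt_exitTime_iff (u : ℝ) (t : ℝ≥0) (ω : PathSpace) :
    (t : ℝ≥0∞) < exitTime u ω ↔ ∀ s ≤ t, X s ω * (X s ω - (s + u)) ≠ 0 := by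
  simp only [exitTime, hit_iff]
  set K : Set ℝ≥0 := {s | X s ω * (X s ω - (s + u)) = 0} with hK
  have hKc : IsClosed K := isClosed_eq (continuous_hit u ω) continuous_const
  constructor
  · intro h s hs h0
    have : sInf ((fun t : ℝ≥0 => (t : ℝ≥0∞)) '' K) ≤ s := sInf_le ⟨s, h0, rfl⟩
    exact absurd (h.trans_le this) (by simpa using hs)
  · intro h
    rcases K.eq_empty_or_nonempty with hE | hE
    · simp [hE]
    · have hmem : sInf K ∈ K := hKc.csInf_mem hE (OrderBot.bddBelow K)
      rw [sInf_image, ← ENNReal.coe_sInf hE, ENNReal.coe_lt_coe]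
      by_contra hle
      exact h _ (not_lt.1 hle) hmem

theorem measurableSet_lt_exitTime (u : ℝ) (t : ℝ≥0) :
    MeasurableSet[naturalFiltration t] {ω | (t : ℝ≥0∞) < exitTime u ω} := by
  -- by compactness the path avoids the boundary on `[0, t]` iff it stays at a positive distance,
  -- which can be tested on a countable dense set of times
  have hne : Nonempty (Iic t) := ⟨⟨t, self_mem_Iic⟩⟩
  set D := TopologicalSpace.denseSeq (Iic t)
  have h : {ω | (t : ℝ≥0∞) < exitTime u ω} = ⋃ n : ℕ, ⋂ i : ℕ,
      {ω | 1 / ((n : ℝ) + 1) ≤ |X (D i) ω * (X (D i) ω - ((D i : ℝ≥0) + u))|} := by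
    ext ω
    simp only [mem_ofPred_eq, lt_exitTime_iff, mem_iUnion, mem_iInter]
    have hc := (continuous_hit u ω).abs
    constructor
    · intro hω
      have hcomp : IsCompact (Icc 0 t) := isCompact_Icc
      obtain ⟨s, hs, hmin⟩ := hcomp.exists_isMinOn ⟨0, by simp⟩ hc.continuousOn
      obtain ⟨n, hn⟩ := exists_nat_one_div_lt (abs_pos.2 (hω s hs.2))
      exact ⟨n, fun i => hn.le.trans (hmin (show (D i : ℝ≥0) ∈ Icc 0 t from ⟨zero_le, (D i).2⟩))⟩
    · rintro ⟨n, hn⟩ s hs h0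
      have hcl : IsClosed {q : Iic t |
          1 / ((n : ℝ) + 1) ≤ |X q ω * (X q ω - ((q : ℝ≥0) + u))|} :=
        isClosed_le continuous_const (hc.comp continuous_subtype_val)
      have hall := hcl.closure_subset_iff.2 (range_subset_iff.2 hn)
        ((TopologicalSpace.denseRange_denseSeq (Iic t)) ⟨s, hs⟩)
      simp only [mem_ofPred_eq, h0, abs_zero] at hall
      exact absurd hall (not_le.2 (by positivity))
  rw [h]
  refine MeasurableSet.iUnion fun n => MeasurableSet.iInter fun i => ?_
  have hX : Measurable[naturalFiltration t] (X (D i)) :=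
    (measurable_X_naturalFiltration _).mono (naturalFiltration.mono (D i).2) le_rfl
  have hXm := hX.mul (hX.sub_const ((D i : ℝ≥0) + u))
  exact measurableSet_le measurable_const (measurable_abs.comp hXm)

theorem mem_wedge_of_lt_exitTime {u : ℝ} {t : ℝ≥0} {ω : PathSpace} (h0 : 0 < X 0 ω)
    (hu : X 0 ω < u) (ht : (t : ℝ≥0∞) < exitTime u ω) : 0 < X t ω ∧ X t ω < t + u := by
  rw [lt_exitTime_iff] at ht
  have hneg : X t ω * (X t ω - (t + u)) < 0 := by
    by_contra hcon
    have h1 : X 0 ω * (X 0 ω - ((0 : ℝ≥0) + u)) ≤ 0 := by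
      refine mul_nonpos_of_nonneg_of_nonpos h0.le ?_
      simp only [NNReal.coe_zero]
      linarith
    obtain ⟨s, hs, hs0⟩ := intermediate_value_Icc (zero_le : 0 ≤ t)
      (continuous_hit u ω).continuousOn ⟨h1, not_lt.1 hcon⟩
    exact ht s hs.2 hs0
  have htu : 0 < (t : ℝ) + u := by
    have := t.coe_nonneg
    linarith
  constructor <;> nlinarith

/-- The process vanishes when the path leaves the wedge. -/
theorem harmonicProcess_exitTime {a u : ℝ} {t : ℝ≥0} {ω : PathSpace} (h : exitTime u ω = t) :
    harmonicProcess a u t ω = 0 := by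
  have h1 : ¬ (t : ℝ≥0∞) < exitTime u ω := by simp [h]
  rw [lt_exitTime_iff] at h1
  push Not at h1
  obtain ⟨s, hs, h0⟩ := h1
  have hts : t ≤ s := by
    by_contra hlt
    have h2 : (s : ℝ≥0∞) < exitTime u ω := by rw [h]; exact_mod_cast not_le.1 hlt
    exact (lt_exitTime_iff u s ω).1 h2 s le_rfl h0
  obtain rfl := le_antisymm hs hts
  rcases (hit_iff u s ω).2 h0 with h2 | h2 <;> simp [harmonicProcess, h2, phi_zero_left, phi_self]

/-! ### Optional stopping for a martingale vanishing at the stopping time -/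

section Stopping

variable {Ω : Type*} {m : MeasurableSpace Ω} {μ : Measure Ω} {F : Filtration ℝ≥0 m}
  {M : ℝ≥0 → Ω → ℝ} {τ : Ω → ℝ≥0∞}

/-- The `j`-th point of the division of `[r, s]` into `n + 1` equal intervals. -/
noncomputable def gridPoint (r s : ℝ≥0) (n j : ℕ) : ℝ≥0 := r + j * ((s - r) / (n + 1))

theorem gridPoint_mono (r s : ℝ≥0) (n : ℕ) : Monotone (gridPoint r s n) := by
  intro i j hij
  unfold gridPoint
  gcongr

theorem gridPoint_zero (r s : ℝ≥0) (n : ℕ) : gridPoint r s n 0 = r := by simp [gridPoint]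

theorem gridPoint_last {r s : ℝ≥0} (hrs : r ≤ s) (n : ℕ) : gridPoint r s n (n + 1) = s := by
  have : ((n : ℝ≥0) + 1) ≠ 0 := by positivity
  rw [gridPoint]
  push_cast
  rw [mul_div_cancel₀ _ this, add_tsub_cancel_of_le hrs]

theorem gridPoint_le {r s : ℝ≥0} (hrs : r ≤ s) {n j : ℕ} (hj : j ≤ n + 1) :
    gridPoint r s n j ≤ s :=
  (gridPoint_mono r s n hj).trans (gridPoint_last hrs n).le

theorem gridPoint_succ (r s : ℝ≥0) (n j : ℕ) :
    gridPoint r s n (j + 1) = gridPoint r s n j + (s - r) / (n + 1) := by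
  simp only [gridPoint]
  push_cast
  ring

/-- The event that `B` occurs and `τ` lies in the `j`-th grid interval. -/
def gridEvent (τ : Ω → ℝ≥0∞) (B : Set Ω) (r s : ℝ≥0) (n j : ℕ) : Set Ω :=
  (B ∩ {ω | (gridPoint r s n j : ℝ≥0∞) < τ ω}) \ {ω | (gridPoint r s n (j + 1) : ℝ≥0∞) < τ ω}

/-- The value of `M` at the first grid point after `τ` where this is at most `1` in absolute value,
and the terminal value `M s` where it is not; zero off `B ∩ {r < τ ≤ s}`. -/
noncomputable def gridValue (M : ℝ≥0 → Ω → ℝ) (τ : Ω → ℝ≥0∞) (B : Set Ω) (r s : ℝ≥0) (n : ℕ)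
    (ω : Ω) : ℝ :=
  ∑ j ∈ Finset.range (n + 1), (gridEvent τ B r s n j).indicator
    (fun ω => if |M (gridPoint r s n (j + 1)) ω| ≤ 1 then M (gridPoint r s n (j + 1)) ω
      else M s ω) ω

theorem measurableSet_gridEvent (hτ : ∀ t : ℝ≥0, MeasurableSet[F t] {ω | (t : ℝ≥0∞) < τ ω})
    {r s : ℝ≥0} {B : Set Ω} (hB : MeasurableSet[F r] B) (n j : ℕ) :
    MeasurableSet[F (gridPoint r s n (j + 1))] (gridEvent τ B r s n j) := by
  have h0 : r ≤ gridPoint r s n (j + 1) := le_self_add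
  have h1 := gridPoint_mono r s n j.le_succ
  exact ((F.mono h0 _ hB).inter (F.mono h1 _ (hτ _))).diff (hτ _)

theorem gridValue_eq_zero_or (B : Set Ω) (r s : ℝ≥0) (n : ℕ) (ω : Ω) :
    gridValue M τ B r s n ω = 0 ∨ ∃ t₀ t : ℝ≥0, τ ω = t₀ ∧ t₀ ≤ t ∧ t ≤ t₀ + (s - r) / (n + 1) ∧
      gridValue M τ B r s n ω = if |M t ω| ≤ 1 then M t ω else M s ω := by
  by_cases h : ∃ j ∈ Finset.range (n + 1), ω ∈ gridEvent τ B r s n j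
  · obtain ⟨j, hj, hω⟩ := h
    have hω' := hω
    obtain ⟨⟨-, h1⟩, h2⟩ := hω
    simp only [mem_ofPred_eq, not_lt] at h1 h2
    lift τ ω to ℝ≥0 using (h2.trans_lt ENNReal.coe_lt_top).ne with t₀ ht₀
    refine Or.inr ⟨t₀, gridPoint r s n (j + 1), rfl, by exact_mod_cast h2, ?_, ?_⟩
    · rw [gridPoint_succ]
      have h1' : gridPoint r s n j < t₀ := by exact_mod_cast h1
      gcongr
    · rw [gridValue, Finset.sum_eq_single_of_mem j hj, Set.indicator_of_mem hω']
      -- the grid intervals are disjoint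
      intro i _ hij
      refine Set.indicator_of_notMem (fun hi => ?_) _
      obtain ⟨⟨-, h3⟩, h4⟩ := hi
      simp only [mem_ofPred_eq, not_lt, ← ht₀] at h3 h4
      rcases lt_or_gt_of_ne hij with hlt | hlt
      · have h5 : gridPoint r s n (i + 1) ≤ gridPoint r s n j := gridPoint_mono r s n hlt
        exact absurd (h4.trans (ENNReal.coe_le_coe.2 h5)) (not_le.2 h1)
      · have h5 : gridPoint r s n (j + 1) ≤ gridPoint r s n i := gridPoint_mono r s n hlt
        exact absurd (h2.trans (ENNReal.coe_le_coe.2 h5)) (not_le.2 h3)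
  · left
    push Not at h
    exact Finset.sum_eq_zero fun j hj => Set.indicator_of_notMem (h j hj) _

theorem abs_gridValue_le (B : Set Ω) (r s : ℝ≥0) (n : ℕ) (ω : Ω) :
    |gridValue M τ B r s n ω| ≤ 1 + |M s ω| := by
  have hM := abs_nonneg (M s ω)
  rcases gridValue_eq_zero_or (M := M) (τ := τ) B r s n ω with h | ⟨t₀, t, -, -, -, h⟩
  · rw [h, abs_zero]
    positivity
  · rw [h]
    split_ifs with h1 <;> linarith

theorem tendsto_gridValue (hc : ∀ ω, Continuous fun t => M t ω)
    (h0 : ∀ ω (t : ℝ≥0), τ ω = t → M t ω = 0) (B : Set Ω) (r s : ℝ≥0) (ω : Ω) :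
    Tendsto (fun n => gridValue M τ B r s n ω) atTop (𝓝 0) := by
  by_cases hτ : τ ω = ⊤
  · have h (n : ℕ) : gridValue M τ B r s n ω = 0 := by
      rcases gridValue_eq_zero_or (M := M) (τ := τ) B r s n ω with h | ⟨t₀, t, h, -⟩
      · exact h
      · simp [hτ] at h
    simp [h]
  obtain ⟨t₀, ht₀⟩ : ∃ t₀ : ℝ≥0, (t₀ : ℝ≥0∞) = τ ω := ⟨_, ENNReal.coe_toNNReal hτ⟩
  have hM0 := h0 ω t₀ ht₀.symm
  rw [Metric.tendsto_atTop]
  intro ε hε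
  obtain ⟨δ, hδ, hMδ⟩ := Metric.continuous_iff.1 (hc ω) t₀ (min ε 1) (lt_min hε one_pos)
  obtain ⟨N, hN⟩ := exists_nat_gt (((s - r : ℝ≥0) : ℝ) / δ)
  refine ⟨N, fun n hn => ?_⟩
  rcases gridValue_eq_zero_or (M := M) (τ := τ) B r s n ω with h | ⟨t₁, t, h1, h2, h3, h⟩
  · rw [h, dist_self]
    exact hε
  obtain rfl : t₀ = t₁ := by
    rw [h1] at ht₀
    exact_mod_cast ht₀
  have hdist : dist t t₀ < δ := by
    have h2' : (t₀ : ℝ) ≤ t := by exact_mod_cast h2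
    have h3' : (t : ℝ) ≤ t₀ + ((s - r : ℝ≥0) : ℝ) / (n + 1) := by exact_mod_cast h3
    rw [NNReal.dist_eq, abs_of_nonneg (by linarith)]
    have hn1 : (N : ℝ) < n + 1 := by exact_mod_cast Nat.lt_succ_of_le hn
    have : ((s - r : ℝ≥0) : ℝ) / (n + 1) < δ := by
      rw [div_lt_iff₀ (by positivity), mul_comm, ← div_lt_iff₀ hδ]
      exact hN.trans hn1
    linarith
  have hMt := hMδ t hdist
  rw [hM0, Real.dist_eq, sub_zero, lt_min_iff] at hMt
  rw [h, if_pos hMt.2.le, Real.dist_eq, sub_zero]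
  exact hMt.1

theorem integral_gridValue [IsFiniteMeasure μ] (hM : Martingale M F μ)
    (hτ : ∀ t : ℝ≥0, MeasurableSet[F t] {ω | (t : ℝ≥0∞) < τ ω}) {r s : ℝ≥0} (hrs : r ≤ s)
    {B : Set Ω} (hB : MeasurableSet[F r] B) (n : ℕ) :
    Integrable (gridValue M τ B r s n) μ ∧ ∫ ω, gridValue M τ B r s n ω ∂μ =
      ∫ ω in B ∩ {ω | (r : ℝ≥0∞) < τ ω}, M r ω ∂μ -
        ∫ ω in B ∩ {ω | (s : ℝ≥0∞) < τ ω}, M s ω ∂μ := by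
  set g := gridPoint r s n
  set E := gridEvent τ B r s n
  have hE (j : ℕ) : MeasurableSet[F (g (j + 1))] (E j) := measurableSet_gridEvent hτ hB n j
  have hEm (j : ℕ) : MeasurableSet (E j) := F.le _ _ (hE j)
  set f : ℕ → Ω → ℝ := fun j ω => if |M (g (j + 1)) ω| ≤ 1 then M (g (j + 1)) ω else M s ω
  set C : ℕ → Set Ω := fun j => {ω | |M (g (j + 1)) ω| ≤ 1}
  have hC (j : ℕ) : MeasurableSet[F (g (j + 1))] (C j) :=
    measurableSet_le (measurable_abs.comp (hM.1 _).measurable) measurable_const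
  have hf (j : ℕ) : f j = (C j).indicator (M (g (j + 1))) + (C j)ᶜ.indicator (M s) := by
    ext ω
    by_cases hω : |M (g (j + 1)) ω| ≤ 1 <;> simp [f, C, hω]
  have hi1 (j : ℕ) : Integrable ((C j).indicator (M (g (j + 1)))) μ :=
    (hM.integrable _).indicator (F.le _ _ (hC j))
  have hi2 (j : ℕ) : Integrable ((C j)ᶜ.indicator (M s)) μ :=
    (hM.integrable _).indicator (F.le _ _ (hC j).compl)
  have hfint (j : ℕ) : Integrable (f j) μ := by
    rw [hf]
    exact (hi1 j).add (hi2 j)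
  -- by the martingale property the truncation does not change the integral
  have hterm (j : ℕ) (hj : j ∈ Finset.range (n + 1)) :
      ∫ ω in E j, f j ω ∂μ = ∫ ω in E j, M (g (j + 1)) ω ∂μ := by
    have hgs : g (j + 1) ≤ s := gridPoint_le hrs (Finset.mem_range.1 hj)
    have hm1 := F.le _ _ (hC j)
    rw [hf, integral_add' (hi1 j).integrableOn (hi2 j).integrableOn, setIntegral_indicator hm1,
      setIntegral_indicator hm1.compl, ← hM.setIntegral_eq hgs ((hE j).inter (hC j).compl),
      ← sdiff_eq, integral_inter_add_sdiff hm1 (hM.integrable _).integrableOn]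
  have htel (j : ℕ) : ∫ ω in E j, M (g (j + 1)) ω ∂μ =
      ∫ ω in B ∩ {ω | (g j : ℝ≥0∞) < τ ω}, M (g j) ω ∂μ -
        ∫ ω in B ∩ {ω | (g (j + 1) : ℝ≥0∞) < τ ω}, M (g (j + 1)) ω ∂μ := by
    have hgj : g j ≤ g (j + 1) := gridPoint_mono r s n j.le_succ
    have hB' : MeasurableSet[F (g j)] B := F.mono le_self_add _ hB
    have hsub : B ∩ {ω | (g j : ℝ≥0∞) < τ ω} ∩ {ω | (g (j + 1) : ℝ≥0∞) < τ ω} =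
        B ∩ {ω | (g (j + 1) : ℝ≥0∞) < τ ω} := by
      ext ω
      simp only [mem_inter_iff, mem_ofPred_eq]
      have := (ENNReal.coe_le_coe.2 hgj).trans_lt (b := ((g (j + 1) : ℝ≥0) : ℝ≥0∞)) (c := τ ω)
      tauto
    rw [hM.setIntegral_eq hgj (hB'.inter (hτ _)), ← integral_inter_add_sdiff
      (s := B ∩ {ω | (g j : ℝ≥0∞) < τ ω}) (F.le _ _ (hτ (g (j + 1))))
      (hM.integrable _).integrableOn, hsub, add_sub_cancel_left]
    rfl
  have hrw : gridValue M τ B r s n = fun ω => ∑ j ∈ Finset.range (n + 1), (E j).indicator (f j) ω :=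
    rfl
  rw [hrw]
  refine ⟨integrable_finsetSum _ fun j _ => (hfint j).indicator (hEm j), ?_⟩
  rw [integral_finsetSum _ fun j _ => (hfint j).indicator (hEm j)]
  calc ∑ j ∈ Finset.range (n + 1), ∫ ω, (E j).indicator (f j) ω ∂μ
      = ∑ j ∈ Finset.range (n + 1), (∫ ω in B ∩ {ω | (g j : ℝ≥0∞) < τ ω}, M (g j) ω ∂μ -
        ∫ ω in B ∩ {ω | (g (j + 1) : ℝ≥0∞) < τ ω}, M (g (j + 1)) ω ∂μ) := by
        refine Finset.sum_congr rfl fun j hj => ?_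
        rw [integral_indicator (hEm j), hterm j hj, htel]
    _ = _ := by
        rw [Finset.sum_range_sub' fun j => ∫ ω in B ∩ {ω | (g j : ℝ≥0∞) < τ ω}, M (g j) ω ∂μ,
          show g 0 = r from gridPoint_zero r s n, show g (n + 1) = s from gridPoint_last hrs n]

/-- A continuous martingale that vanishes at the stopping time `τ` remains a martingale when it is
killed at `τ`. The contribution of `{r < τ ≤ s}` equals, for every mesh, the integral of a function
dominated by `1 + |M s|` which tends to `0` with the mesh; no uniform integrability is needed. -/
theorem setIntegral_inter_lt_eq [IsFiniteMeasure μ] (hM : Martingale M F μ)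
    (hc : ∀ ω, Continuous fun t => M t ω)
    (hτ : ∀ t : ℝ≥0, MeasurableSet[F t] {ω | (t : ℝ≥0∞) < τ ω})
    (h0 : ∀ ω (t : ℝ≥0), τ ω = t → M t ω = 0) {r s : ℝ≥0} (hrs : r ≤ s)
    {B : Set Ω} (hB : MeasurableSet[F r] B) :
    ∫ ω in B ∩ {ω | (s : ℝ≥0∞) < τ ω}, M s ω ∂μ =
      ∫ ω in B ∩ {ω | (r : ℝ≥0∞) < τ ω}, M r ω ∂μ := by
  have hlim := tendsto_integral_of_dominated_convergence (μ := μ)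
    (F := fun n => gridValue M τ B r s n) (f := fun _ => 0) (fun ω => 1 + |M s ω|)
    (fun n => (integral_gridValue hM hτ hrs hB n).1.aestronglyMeasurable)
    ((integrable_const 1).add (hM.integrable s).abs)
    (fun n => Eventually.of_forall fun ω => abs_gridValue_le B r s n ω)
    (Eventually.of_forall fun ω => tendsto_gridValue hc h0 B r s ω)
  simp only [(integral_gridValue hM hτ hrs hB _).2, integral_zero] at hlim
  have := tendsto_nhds_unique tendsto_const_nhds hlim
  linarith

end Stopping

/-! ### Transfer to the conditioned measure -/

section Conditioned

variable {x u : ℝ} {W Q : Measure PathSpace}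

theorem IsWienerMeasure.setIntegral_phi_inter_exitTime (hW : IsWienerMeasure x W) (a : ℝ)
    (hu : 0 < u) {r s : ℝ≥0} (hrs : r ≤ s) {A : Set PathSpace}
    (hA : MeasurableSet[naturalFiltration r] A) :
    ∫ ω in A ∩ {ω | (s : ℝ≥0∞) < exitTime u ω}, phi a (X s ω) (s + u) ∂W =
      Real.exp (-(a ^ 2 / 2) * (s - r)) *
        ∫ ω in A ∩ {ω | (r : ℝ≥0∞) < exitTime u ω}, phi a (X r ω) (r + u) ∂W := by
  have := hW.isProbabilityMeasure
  have h := setIntegral_inter_lt_eq (hW.martingale_harmonicProcess a hu)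
    (continuous_harmonicProcess_path a hu) (measurableSet_lt_exitTime u)
    (fun ω t => harmonicProcess_exitTime) hrs hA
  simp only [harmonicProcess] at h
  rw [integral_const_mul, integral_const_mul] at h
  have he : Real.exp (-(a ^ 2 / 2) * (s - r)) =
      (Real.exp (a ^ 2 / 2 * s))⁻¹ * Real.exp (a ^ 2 / 2 * r) := by
    rw [← Real.exp_neg, ← Real.exp_add]
    ring_nf
  rw [he, mul_assoc, ← h, inv_mul_cancel_left₀ (Real.exp_ne_zero _)]

/-- On `𝓕_t` the conditioned measure has a density with respect to Wiener measure killed at the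
exit time. -/
theorem IsConditionedMeasure.trim_eq (hQ : IsConditionedMeasure x u W Q) (t : ℝ≥0) :
    Q.trim (naturalFiltration.le t) =
      ((W.restrict {ω | (t : ℝ≥0∞) < exitTime u ω}).withDensity fun ω =>
        ENNReal.ofReal (phi 0 (X t ω) (t + u) / phi 0 x u)).trim (naturalFiltration.le t) := by
  refine @Measure.ext _ (naturalFiltration t) _ _ fun A hA => ?_
  have hAm := naturalFiltration.le t A hA
  rw [trim_measurableSet_eq _ hA, trim_measurableSet_eq _ hA, hQ t A hA,
    withDensity_apply _ hAm, Measure.restrict_restrict hAm, inter_comm]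

theorem IsConditionedMeasure.isProbabilityMeasure (hx : 0 < x) (hxu : x < u)
    (hW : IsWienerMeasure x W) (hQ : IsConditionedMeasure x u W Q) : IsProbabilityMeasure Q := by
  have := hW.isProbabilityMeasure
  have h0 : ∀ᵐ ω ∂W, ((0 : ℝ≥0) : ℝ≥0∞) < exitTime u ω := by
    filter_upwards [hW.ae_X_zero] with ω hω
    rw [lt_exitTime_iff]
    intro s hs
    obtain rfl : s = 0 := le_antisymm hs zero_le
    rw [hω, NNReal.coe_zero, zero_add]
    exact mul_ne_zero hx.ne' (by linarith)
  have h1 : ∀ᵐ ω ∂W, ENNReal.ofReal (phi 0 (X 0 ω) ((0 : ℝ≥0) + u) / phi 0 x u) = 1 := by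
    filter_upwards [hW.ae_X_zero] with ω hω
    rw [hω, NNReal.coe_zero, zero_add, div_self (phi_zero_pos hx hxu).ne', ENNReal.ofReal_one]
  constructor
  rw [hQ 0 univ MeasurableSet.univ, inter_univ, lintegral_congr_ae (ae_restrict_of_ae h1),
    lintegral_one, Measure.restrict_apply_univ]
  exact prob_compl_eq_zero_iff₀
    (naturalFiltration.le 0 _ (measurableSet_lt_exitTime u 0)).nullMeasurableSet |>.1 h0

/-- The density cancels the denominator, since `φ₀ > 0` inside the wedge. -/
theorem IsConditionedMeasure.integrable_div_and_setIntegral_div (hx : 0 < x) (hxu : x < u)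
    (hW : IsWienerMeasure x W) (hQ : IsConditionedMeasure x u W Q) (a : ℝ) (t : ℝ≥0) :
    Integrable (fun ω => phi a (X t ω) (t + u) / phi 0 (X t ω) (t + u)) Q ∧
      ∀ A, MeasurableSet[naturalFiltration t] A →
        ∫ ω in A, phi a (X t ω) (t + u) / phi 0 (X t ω) (t + u) ∂Q =
          (∫ ω in A ∩ {ω | (t : ℝ≥0∞) < exitTime u ω}, phi a (X t ω) (t + u) ∂W) / phi 0 x u := by
  have hu : 0 < u := hx.trans hxu
  have hle := naturalFiltration.le t
  have hpos := phi_zero_pos hx hxu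
  set S := {ω | (t : ℝ≥0∞) < exitTime u ω}
  have hS : MeasurableSet S := hle _ (measurableSet_lt_exitTime u t)
  set d : PathSpace → ℝ≥0∞ := fun ω => ENNReal.ofReal (phi 0 (X t ω) (t + u) / phi 0 x u)
  set f : PathSpace → ℝ := fun ω => phi a (X t ω) (t + u) / phi 0 (X t ω) (t + u)
  have hf : Measurable[naturalFiltration t] f :=
    (measurable_phi_X a hu t).div (measurable_phi_X 0 hu t)
  have hd : Measurable d :=
    (((measurable_phi_X 0 hu t).mono hle le_rfl).div_const _).ennreal_ofReal
  have hcancel : ∀ᵐ ω ∂W.restrict S, (d ω).toReal • f ω = phi a (X t ω) (t + u) / phi 0 x u := by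
    filter_upwards [ae_restrict_of_ae hW.ae_X_zero, ae_restrict_mem hS] with ω h0 hω
    obtain ⟨h1, h2⟩ := mem_wedge_of_lt_exitTime (h0 ▸ hx) (h0 ▸ hxu) hω
    have h3 := phi_zero_pos h1 h2
    simp only [d, f]
    rw [ENNReal.toReal_ofReal (by positivity), smul_eq_mul]
    field_simp
  have hfW : Integrable f ((W.restrict S).withDensity d) := by
    rw [integrable_withDensity_iff_integrable_smul' hd (Eventually.of_forall fun _ => by simp [d]),
      integrable_congr hcancel]
    exact (hW.integrable_phi a hu t).restrict.div_const _
  refine ⟨integrable_of_integrable_trim hle ?_, fun A hA => ?_⟩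
  · rw [hQ.trim_eq]
    exact hfW.trim hle hf.stronglyMeasurable
  have hAm := hle A hA
  have hfA : StronglyMeasurable[naturalFiltration t] (A.indicator f) :=
    hf.stronglyMeasurable.indicator hA
  rw [← integral_indicator hAm, integral_trim hle hfA, hQ.trim_eq, ← integral_trim hle hfA,
    integral_indicator hAm, setIntegral_withDensity_eq_setIntegral_toReal_smul hd
      (Eventually.of_forall fun _ => by simp [d]) _ hAm,
    integral_congr_ae (ae_restrict_of_ae hcancel), Measure.restrict_restrict hAm, integral_div]

theorem IsConditionedMeasure.setIntegral_div_eq (hx : 0 < x) (hxu : x < u)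
    (hW : IsWienerMeasure x W) (hQ : IsConditionedMeasure x u W Q) (a : ℝ) {r s : ℝ≥0}
    (hrs : r ≤ s) {A : Set PathSpace} (hA : MeasurableSet[naturalFiltration r] A) :
    ∫ ω in A, phi a (X s ω) (s + u) / phi 0 (X s ω) (s + u) ∂Q =
      Real.exp (-(a ^ 2 / 2) * (s - r)) *
        ∫ ω in A, phi a (X r ω) (r + u) / phi 0 (X r ω) (r + u) ∂Q := by
  rw [(hQ.integrable_div_and_setIntegral_div hx hxu hW a s).2 A (naturalFiltration.mono hrs A hA),
    (hQ.integrable_div_and_setIntegral_div hx hxu hW a r).2 A hA,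
    hW.setIntegral_phi_inter_exitTime a (hx.trans hxu) hrs hA, mul_div_assoc]

theorem IsConditionedMeasure.ae_X_zero (hW : IsWienerMeasure x W)
    (hQ : IsConditionedMeasure x u W Q) : ∀ᵐ ω ∂Q, X 0 ω = x := by
  have hm : MeasurableSet[naturalFiltration 0] {ω | X 0 ω = x}ᶜ :=
    (measurable_X_naturalFiltration 0 (measurableSet_singleton x)).compl
  have h0 : W {ω | X 0 ω = x}ᶜ = 0 := hW.ae_X_zero
  change Q {ω | X 0 ω = x}ᶜ = 0
  rw [hQ 0 _ hm]
  exact setLIntegral_measure_zero _ _ (measure_mono_null inter_subset_right h0)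

end Conditioned

end SpaceTimeBM

theorem mainTheorem3 (a x u : ℝ) (hx : 0 < x) (hxu : x < u)
    (r t : ℝ≥0) (hr : 0 < r) (ht : 0 < t)
    (W Q : Measure SpaceTimeBM.PathSpace)
    (hW : SpaceTimeBM.IsWienerMeasure x W)
    (hQ : SpaceTimeBM.IsConditionedMeasure x u W Q) :
    (Integrable (fun ω => SpaceTimeBM.phi a (SpaceTimeBM.X t ω) (t + u) /
        SpaceTimeBM.phi 0 (SpaceTimeBM.X t ω) (t + u)) Q ∧
      ∫ ω, SpaceTimeBM.phi a (SpaceTimeBM.X t ω) (t + u) /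
          SpaceTimeBM.phi 0 (SpaceTimeBM.X t ω) (t + u) ∂Q =
        SpaceTimeBM.phi a x u / SpaceTimeBM.phi 0 x u * Real.exp (-(a ^ 2 / 2) * t)) ∧
    (Integrable (fun ω => SpaceTimeBM.phi a (SpaceTimeBM.X (t + r) ω) (t + r + u) /
        SpaceTimeBM.phi 0 (SpaceTimeBM.X (t + r) ω) (t + r + u)) Q ∧
      Q[fun ω => SpaceTimeBM.phi a (SpaceTimeBM.X (t + r) ω) (t + r + u) /
          SpaceTimeBM.phi 0 (SpaceTimeBM.X (t + r) ω) (t + r + u) |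
            SpaceTimeBM.naturalFiltration r] =ᵐ[Q]
        fun ω => SpaceTimeBM.phi a (SpaceTimeBM.X r ω) (r + u) /
          SpaceTimeBM.phi 0 (SpaceTimeBM.X r ω) (r + u) * Real.exp (-(a ^ 2 / 2) * t)) := by
  have hprob := hQ.isProbabilityMeasure hx hxu hW
  have hu : 0 < u := hx.trans hxu
  have hint (s : ℝ≥0) := (hQ.integrable_div_and_setIntegral_div hx hxu hW a s).1
  have hint' := hint (t + r)
  rw [NNReal.coe_add] at hint'
  refine ⟨⟨hint t, ?_⟩, hint', ?_⟩
  · have h := hQ.setIntegral_div_eq hx hxu hW a (zero_le : 0 ≤ t) MeasurableSet.univ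
    have h0 : ∫ ω, SpaceTimeBM.phi a (SpaceTimeBM.X 0 ω) ((0 : ℝ≥0) + u) /
        SpaceTimeBM.phi 0 (SpaceTimeBM.X 0 ω) ((0 : ℝ≥0) + u) ∂Q =
          SpaceTimeBM.phi a x u / SpaceTimeBM.phi 0 x u := by
      rw [integral_congr_ae (g := fun _ => SpaceTimeBM.phi a x u / SpaceTimeBM.phi 0 x u)]
      · simp
      · filter_upwards [hQ.ae_X_zero hW] with ω hω
        rw [hω, NNReal.coe_zero, zero_add]
    rw [setIntegral_univ, setIntegral_univ, h0, NNReal.coe_zero, sub_zero] at h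
    rw [h, mul_comm]
  · refine (ae_eq_condExp_of_forall_setIntegral_eq (SpaceTimeBM.naturalFiltration.le r) hint'
      (fun _ _ _ => ((hint r).mul_const _).integrableOn) (fun A hA _ => ?_) ?_).symm
    · have h := hQ.setIntegral_div_eq hx hxu hW a (le_add_self : r ≤ t + r) hA
      rw [NNReal.coe_add, add_sub_cancel_right] at h
      rw [h, integral_mul_const, mul_comm]
    · exact (((SpaceTimeBM.measurable_phi_X a hu r).div
        (SpaceTimeBM.measurable_phi_X 0 hu r)).mul_const _).stronglyMeasurable.aestronglyMeasurable
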